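/- Let $X,Y$ be real Hilbert spaces, let $G:X\to\mathbb R\cup\{+\infty\}$ and $F^*:Y\to\mathbb R\cup\{+\infty\}$ be proper, convex and lower semicontinuous, let $Q:X\to\mathbb R$ and $P^*:Y\to\mathbb R$ be convex and differentiable with Lipschitz continuous gradients, with Lipschitz constants $L_Q\ge 0$ and $L_P\ge 0$ respectively, and let $K:X\to Y$ be linear and bounded. Assume that the saddle-point problem $$\min_{x\in X}\max_{y\in Y}\; G(x)+Q(x)+\langle Kx,y\rangle-F^*(y)-P^*(y)$$ has at least one solution (saddle point). Let $\tau,\sigma$ satisfy $$0<\tau<\frac{2}{L_Q},\qquad 0<\sigma<\frac{2}{L_P},\qquad \|K\|^2<\Big(\frac1\tau-\frac{L_Q}{2}\Big)\Big(\frac1\sigma-\frac{L_P}{2}\Big)$$ (with $2/0=+\infty$), let $\alpha<1$, and let $(\alpha_k)_{k\ge0}$ be a sequence in $[0,\alpha]$. Given $x^{-1},x^0\in X$ and $y^{-1},y^0\in Y$, let $(x^k,y^k)$ be the iterates of the inertial primal-dual forward-backward method, for $k\ge 0$, $$\begin{cases}\xi^k=x^k+\alpha_k(x^k-x^{k-1}),\\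 \zeta^k=y^k+\alpha_k(y^k-y^{k-1}),\\ x^{k+1}=(\mathrm{id}+\tau\,\partial G)^{-1}\big(\xi^k-\tau(\nabla Q(\xi^k)+K^*\zeta^k)\big),\\ \bar\xi^{k+1}=2x^{k+1}-\xi^k,\\ y^{k+1}=(\mathrm{id}+\sigma\,\partial F^*)^{-1}\big(\zeta^k-\sigma(\nabla P^*(\zeta^k)-K\bar\xi^{k+1})\big).\end{cases}$$ Put $\|z\|_M^2=\langle Mz,z\rangle$ for $z\in X\times Y$, where $M=\begin{pmatrix}\frac1\tau\mathrm{id}&-K^*\\-K&\frac1\sigma\mathrm{id}\end{pmatrix}$. (a) If $$\sum_{k=1}^\infty\alpha_k\,\big\|(x^k,y^k)-(x^{k-1},y^{k-1})\big\|_M^2<\infty,\tag{1}$$ then $(x^k,y^k)$ converges weakly in $X\times Y$ to a solution (saddle point) of the saddle-point problem. (b) Condition (1) is fulfilled if $(\alpha_k)$ is nondecreasing and there exists $\varepsilon>0$ such that for all $k$ $$\frac{1-3\alpha_k-\varepsilon}{\tau}\ge\frac{(1-\alpha_k)^2}{2}L_Q,\qquad \frac{1-3\alpha_k-\varepsilon}{\sigma}\ge\frac{(1-\alpha_k)^2}{2}L_P,$$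 $$\Big(\frac{1-3\alpha_k-\varepsilon}{\tau}-\frac{(1-\alpha_k)^2}{2}L_Q\Big)\Big(\frac{1-3\alpha_k-\varepsilon}{\sigma}-\frac{(1-\alpha_k)^2}{2}L_P\Big)\ge(1-3\alpha_k-\varepsilon)^2\|K\|^2.$$ -/

import Mathlib

open Filter Topology
open scoped NNReal

namespace IPDFB

noncomputable section

/-- Proper, convex, lower semicontinuous functions with values in `ℝ ∪ {+∞}`. -/
structure IsProperConvexLsc {H : Type*} [NormedAddCommGroup H] [InnerProductSpace ℝ H]
    (f : H → EReal) : Prop where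
  ne_bot : ∀ x, f x ≠ ⊥
  exists_ne_top : ∃ x, f x ≠ ⊤
  convex : ∀ x y : H, ∀ a b : ℝ, 0 < a → 0 < b → a + b = 1 →
    f (a • x + b • y) ≤ (a : EReal) * f x + (b : EReal) * f y
  lsc : LowerSemicontinuous f

/-- The convex subdifferential `∂f`, as a set-valued operator. -/
def subdiff {H : Type*} [NormedAddCommGroup H] [InnerProductSpace ℝ H]
    (f : H → EReal) (x : H) : Set H :=
  {p | ∀ z, f x + ((inner ℝ p (z - x) : ℝ) : EReal) ≤ f z}

/-- The resolvent `(id + t T)⁻¹` of a set-valued operator `T`, as a set-valued operator: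
`u ∈ (id + t T)⁻¹ v` iff `v ∈ u + t T u`. -/
def resolvent {H : Type*} [NormedAddCommGroup H] [InnerProductSpace ℝ H]
    (t : ℝ) (T : H → Set H) (v : H) : Set H :=
  {u | ∃ p ∈ T u, v = u + t • p}

section PrimalDual

variable {X Y : Type*} [NormedAddCommGroup X] [InnerProductSpace ℝ X] [CompleteSpace X]
  [NormedAddCommGroup Y] [InnerProductSpace ℝ Y] [CompleteSpace Y]

/-- The convex-concave function `G x + Q x + ⟨K x, y⟩ - F* y - P* y`. -/
def saddleFun (G : X → EReal) (Q : X → ℝ) (K : X →L[ℝ] Y) (Fs : Y → EReal) (Ps : Y → ℝ)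
    (x : X) (y : Y) : EReal :=
  G x + ((Q x + inner ℝ (K x) y - Ps y : ℝ) : EReal) - Fs y

/-- `(x, y)` solves `min_x max_y G x + Q x + ⟨K x, y⟩ - F* y - P* y`, i.e. it is a saddle point.
Saddle points have finite values `G x`, `F* y`, so that no `∞ - ∞` occurs below. -/
structure IsSaddlePoint (G : X → EReal) (Q : X → ℝ) (K : X →L[ℝ] Y) (Fs : Y → EReal)
    (Ps : Y → ℝ) (x : X) (y : Y) : Prop where
  primal_ne_top : G x ≠ ⊤
  dual_ne_top : Fs y ≠ ⊤
  max_right : ∀ y' : Y, saddleFun G Q K Fs Ps x y' ≤ saddleFun G Q K Fs Ps x y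
  min_left : ∀ x' : X, saddleFun G Q K Fs Ps x y ≤ saddleFun G Q K Fs Ps x' y

/-- The block operator `M = [τ⁻¹ id, -K*; -K, σ⁻¹ id]` on the Hilbert space `X × Y`. -/
def metricOp (τ σ : ℝ) (K : X →L[ℝ] Y) (z : WithLp 2 (X × Y)) : WithLp 2 (X × Y) :=
  WithLp.toLp 2 (τ⁻¹ • z.fst - ContinuousLinearMap.adjoint K z.snd, -K z.fst + σ⁻¹ • z.snd)

/-- The squared `M`-norm `‖z‖_M² = ⟨M z, z⟩`. -/
def metricNormSq (τ σ : ℝ) (K : X →L[ℝ] Y) (z : WithLp 2 (X × Y)) : ℝ :=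
  inner ℝ (metricOp τ σ K z) z

/-- The sequence `k ↦ u (k - 1)` for a sequence `u` indexed from `-1`, whose entry at `-1`
is `a` and whose further entries are `u 0, u 1, …`. -/
def prev {H : Type*} (a : H) (u : ℕ → H) : ℕ → H
  | 0 => a
  | k + 1 => u k

/-- Inertial extrapolation `u k + α k (u k - u (k - 1))`, with `a` in the place of `u (-1)`. -/
def extrapolate {H : Type*} [NormedAddCommGroup H] [InnerProductSpace ℝ H]
    (α : ℕ → ℝ) (a : H) (u : ℕ → H) (k : ℕ) : H :=
  u k + α k • (u k - prev a u k)

/-- `(x k, y k)` are iterates of the inertial primal-dual forward-backward method, started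
from `(xm, ym)` and `(x 0, y 0)`. -/
structure IsIterates (G : X → EReal) (Q : X → ℝ) (K : X →L[ℝ] Y) (Fs : Y → EReal)
    (Ps : Y → ℝ) (τ σ : ℝ) (α : ℕ → ℝ) (xm : X) (ym : Y) (x : ℕ → X) (y : ℕ → Y) : Prop where
  primal_step : ∀ k, x (k + 1) ∈ resolvent τ (subdiff G)
    (extrapolate α xm x k - τ • (gradient Q (extrapolate α xm x k)
      + ContinuousLinearMap.adjoint K (extrapolate α ym y k)))
  dual_step : ∀ k, y (k + 1) ∈ resolvent σ (subdiff Fs)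
    (extrapolate α ym y k - σ • (gradient Ps (extrapolate α ym y k)
      - K ((2 : ℝ) • x (k + 1) - extrapolate α xm x k)))

end PrimalDual

end

end IPDFB

/-!
The optimality system of the saddle-point problem is an inclusion `0 ∈ A z + B z` on `X × Y`, where
`A` collects the two subdifferentials and the skew coupling by `K`, and `B = (∇Q, ∇P*)`. One step of
the method is a forward-backward step for this inclusion in the metric of `M`. Monotonicity of `A`
and the three-point form of the Baillon–Haddad theorem (`neg_le_inner_gradient_sub`) give, for every
saddle point `p` and the extrapolated point `w`,
`‖z⁺ - p‖²_M + ‖z⁺ - w‖²_R ≤ ‖w - p‖²_M` with `R = M - L / 2`, `L = diag (LQ, LP)` (`fejer_step`).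
The step size conditions make `R`, and hence `M`, coercive.

For weak convergence, expanding `‖w - p‖²_M` turns this inequality into a recursion whose increments
contract up to the summable errors `α_k ‖z^k - z^{k-1}‖²_M`. Hence the distances to every saddle
point converge and `z⁺ - w → 0` (`exists_tendsto_and_summable_of_fejer`). Opial's argument
(`exists_weaklyTendsto_of_opial`) then only needs that weak cluster points are saddle points
(`isSaddlePoint_of_weaklyTendsto`): adding the primal and dual subgradient inequalities cancels the
bilinear terms, and `G` and `F*` are weakly lower semicontinuous. Cluster points are taken along
ultrafilters, so no separability is needed.

For the summability criterion, the inertial Fejér inequality makes an energy decrease by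
`ε ‖z^{k+1} - z^k‖²_M` per step (`summable_step_of_fejer`); the three inequalities imposed on
`α_k` make `(1 - 3 α_k - ε) M - (1 - α_k)² L / 2` positive semidefinite.
-/

namespace IPDFB

/-! ### Weak convergence in Hilbert spaces -/

section Weak

variable {H : Type*} [NormedAddCommGroup H] [InnerProductSpace ℝ H]

/-- Weak convergence of a family in a Hilbert space along a filter, tested against the vectors of
the space. -/
def WeaklyTendsto {ι : Type*} (z : ι → H) (l : Filter ι) (p : H) : Prop :=
  ∀ v : H, Tendsto (fun k => inner ℝ v (z k)) l (𝓝 (inner ℝ v p))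

theorem WeaklyTendsto.tendsto_toWeakSpace [CompleteSpace H] {ι : Type*} {z : ι → H}
    {l : Filter ι} {p : H} (h : WeaklyTendsto z l p) :
    Tendsto (fun k => toWeakSpace ℝ H (z k)) l (𝓝 (toWeakSpace ℝ H p)) := by
  refine (WeakBilin.tendsto_iff_forall_eval_tendsto (topDualPairing ℝ H).flip
    (fun u v huv => ?_)).2 fun f => ?_
  · exact ext_inner_left ℝ fun w => by
      simpa using LinearMap.congr_fun huv (InnerProductSpace.toDual ℝ H w)
  · have := h ((InnerProductSpace.toDual ℝ H).symm f)
    simp only [InnerProductSpace.toDual_symm_apply] at this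
    exact this

/-- Bounded families have weak limits along ultrafilters (Banach–Alaoglu). -/
theorem exists_weaklyTendsto_of_bounded [CompleteSpace H] {ι : Type*} {z : ι → H} {C : ℝ}
    (hz : ∀ k, ‖z k‖ ≤ C) (U : Ultrafilter ι) : ∃ p, WeaklyTendsto z U p := by
  let D : ι → WeakDual ℝ H := fun k =>
    StrongDual.toWeakDual (InnerProductSpace.toDual ℝ H (z k))
  have hmem : ∀ᶠ f in (U.map D : Filter _),
      f ∈ WeakDual.toStrongDual ⁻¹' Metric.closedBall (0 : StrongDual ℝ H) C := by
    refine Eventually.of_forall (f := (U : Filter ι)) fun k => ?_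
    simpa [D] using hz k
  obtain ⟨f, -, hf⟩ := (WeakDual.isCompact_closedBall (𝕜 := ℝ) (0 : StrongDual ℝ H) C)
    |>.ultrafilter_le_nhds (U.map D) (le_principal_iff.2 hmem)
  refine ⟨(InnerProductSpace.toDual ℝ H).symm (WeakDual.toStrongDual f), fun v => ?_⟩
  have h1 : Tendsto D U (𝓝 f) := hf
  have h2 := (WeakDual.eval_continuous v).tendsto f |>.comp h1
  rw [real_inner_comm, InnerProductSpace.toDual_symm_apply]
  refine h2.congr fun k => ?_
  simp [D, real_inner_comm]

/-- A lower semicontinuous convex function is weakly lower semicontinuous: its closed sublevel sets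
are separated from outside points by functionals. -/
theorem IsProperConvexLsc.eventually_lt [CompleteSpace H] {f : H → EReal}
    (hf : IsProperConvexLsc f) {ι : Type*} {z : ι → H} {l : Filter ι} {p : H}
    (h : WeaklyTendsto z l p) {a : ℝ} (ha : (a : EReal) < f p) :
    ∀ᶠ k in l, (a : EReal) < f (z k) := by
  have hconv : Convex ℝ {x | f x ≤ a} := by
    rw [convex_iff_forall_pos]
    intro x hx y hy s t hs ht hst
    refine (hf.convex x y s t hs ht hst).trans ?_
    calc (s : EReal) * f x + (t : EReal) * f y
        ≤ (s : EReal) * (a : EReal) + (t : EReal) * (a : EReal) :=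
          add_le_add (mul_le_mul_of_nonneg_left hx (by exact_mod_cast hs.le))
            (mul_le_mul_of_nonneg_left hy (by exact_mod_cast ht.le))
      _ = (a : EReal) := by
          norm_cast
          rw [← add_mul, hst, one_mul]
  have hclosed : IsClosed {x | f x ≤ a} := hf.lsc.isClosed_preimage a
  obtain ⟨g, u, hg, hu⟩ := geometric_hahn_banach_closed_point hconv hclosed
    (x := p) (by simpa using ha)
  have hg' := h ((InnerProductSpace.toDual ℝ H).symm g)
  simp only [InnerProductSpace.toDual_symm_apply] at hg'
  filter_upwards [hg'.eventually_const_lt hu] with k hk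
  by_contra hcon
  exact (hg (z k) (not_lt.1 hcon)).not_gt hk

theorem exists_norm_le_of_tendsto {M : H →L[ℝ] H} {c : ℝ} (hc : 0 < c)
    (hMc : ∀ u, c * ‖u‖ ^ 2 ≤ inner ℝ (M u) u) {z : ℕ → H} {p : H} {l : ℝ}
    (hl : Tendsto (fun k => inner ℝ (M (z k - p)) (z k - p)) atTop (𝓝 l)) :
    ∃ C, ∀ k, ‖z k‖ ≤ C := by
  obtain ⟨b, hb⟩ := hl.bddAbove_range
  refine ⟨√(b / c) + ‖p‖, fun k => ?_⟩
  have h1 : ‖z k - p‖ ^ 2 ≤ b / c := by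
    rw [le_div_iff₀ hc, mul_comm]
    exact (hMc _).trans (hb ⟨k, rfl⟩)
  have h2 := norm_add_le (z k - p) p
  rw [sub_add_cancel] at h2
  have := Real.le_sqrt_of_sq_le h1
  linarith

/-- Opial's lemma in the norm of a positive definite operator `M`. -/
theorem exists_weaklyTendsto_of_opial [CompleteSpace H] {M : H →L[ℝ] H}
    (hM : ∀ u v, inner ℝ (M u) v = inner ℝ (M v) u) {c : ℝ} (hc : 0 < c)
    (hMc : ∀ u, c * ‖u‖ ^ 2 ≤ inner ℝ (M u) u) {Z : Set H} (hZ : Z.Nonempty) {z : ℕ → H}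
    (hconv : ∀ p ∈ Z, ∃ l, Tendsto (fun k => inner ℝ (M (z k - p)) (z k - p)) atTop (𝓝 l))
    (hclus : ∀ U : Ultrafilter ℕ, (U : Filter ℕ) ≤ atTop → ∀ p, WeaklyTendsto z U p → p ∈ Z) :
    ∃ p ∈ Z, WeaklyTendsto z atTop p := by
  obtain ⟨C, hC⟩ : ∃ C, ∀ k, ‖z k‖ ≤ C := by
    obtain ⟨p, hp⟩ := hZ
    obtain ⟨l, hl⟩ := hconv p hp
    exact exists_norm_le_of_tendsto hc hMc hl
  have huniq : ∀ U V : Ultrafilter ℕ, (U : Filter ℕ) ≤ atTop → (V : Filter ℕ) ≤ atTop →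
      ∀ p q, WeaklyTendsto z U p → WeaklyTendsto z V q → p = q := by
    intro U V hU hV p q hp hq
    obtain ⟨l, hl⟩ := hconv p (hclus U hU p hp)
    obtain ⟨l', hl'⟩ := hconv q (hclus V hV q hq)
    -- the difference of the two squared distances is affine in `z k`
    have hlim : Tendsto (fun k => inner ℝ (M (p - q)) (z k)) atTop
        (𝓝 ((l' - l + inner ℝ (M p) p - inner ℝ (M q) q) / 2)) := by
      refine ((((hl'.sub hl).add_const (inner ℝ (M p) p)).sub_const
        (inner ℝ (M q) q)).div_const 2).congr fun k => ?_
      simp only [map_sub, inner_sub_left, inner_sub_right]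
      rw [hM (z k) p, hM (z k) q]
      ring
    have h1 := tendsto_nhds_unique (hp (M (p - q))) (hlim.mono_left hU)
    have h2 := tendsto_nhds_unique (hq (M (p - q))) (hlim.mono_left hV)
    have h3 : inner ℝ (M (p - q)) (p - q) = 0 := by
      rw [inner_sub_right, h1, h2, sub_self]
    have h4 := hMc (p - q)
    rw [h3] at h4
    have h5 : ‖p - q‖ ^ 2 ≤ 0 := by
      by_contra hcon
      push Not at hcon
      have := mul_pos hc hcon
      linarith
    have h6 : ‖p - q‖ = 0 := by nlinarith [norm_nonneg (p - q)]
    exact sub_eq_zero.1 (norm_eq_zero.1 h6)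
  obtain ⟨p, hp⟩ := exists_weaklyTendsto_of_bounded hC (Ultrafilter.of atTop)
  refine ⟨p, hclus _ (Ultrafilter.of_le _) p hp, fun v => ?_⟩
  rw [tendsto_iff_ultrafilter]
  intro U hU
  obtain ⟨q, hq⟩ := exists_weaklyTendsto_of_bounded hC U
  rw [huniq _ U (Ultrafilter.of_le _) hU p q hp hq]
  exact hq v

end Weak

/-! ### Smooth convex functions -/

section Smooth

variable {H : Type*} [NormedAddCommGroup H] [InnerProductSpace ℝ H] [CompleteSpace H]

theorem hasDerivAt_comp_add_smul {f : H → ℝ} (hf : Differentiable ℝ f) (x d : H) (t : ℝ) :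
    HasDerivAt (fun s : ℝ => f (x + s • d)) (inner ℝ (gradient f (x + t • d)) d) t := by
  have h1 : HasDerivAt (fun s : ℝ => x + s • d) d t := by
    simpa using ((hasDerivAt_id t).smul_const d).const_add x
  have h2 := ((hf (x + t • d)).hasGradientAt.hasFDerivAt).comp_hasDerivAt t h1
  simpa [Function.comp_def] using h2

theorem add_inner_gradient_le {f : H → ℝ} (hc : ConvexOn ℝ Set.univ f)
    (hf : Differentiable ℝ f) (x y : H) :
    f x + inner ℝ (gradient f x) (y - x) ≤ f y := by
  have hconv : ConvexOn ℝ Set.univ (fun s : ℝ => f (x + s • (y - x))) := by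
    have := hc.comp_affineMap (AffineMap.lineMap x y : ℝ →ᵃ[ℝ] H)
    simpa [Function.comp_def, AffineMap.lineMap_apply, add_comm] using this
  have h := hconv.le_slope_of_hasDerivAt (Set.mem_univ 0) (Set.mem_univ 1) one_pos
    (hasDerivAt_comp_add_smul hf x (y - x) 0)
  simp only [slope_def_field, zero_smul, one_smul, add_zero, sub_zero, div_one,
    add_sub_cancel] at h
  linarith

/-- The descent lemma for a function with Lipschitz gradient. -/
theorem le_add_inner_gradient_add_sq {f : H → ℝ} (hf : Differentiable ℝ f) {L : ℝ≥0}
    (hL : LipschitzWith L (gradient f)) (x y : H) :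
    f y ≤ f x + inner ℝ (gradient f x) (y - x) + L / 2 * ‖y - x‖ ^ 2 := by
  set d := y - x with hd
  let g : ℝ → ℝ := fun s => f (x + s • d) - s * inner ℝ (gradient f x) d - s ^ 2 * (L / 2 * ‖d‖ ^ 2)
  have hg : ∀ t, HasDerivAt g (inner ℝ (gradient f (x + t • d)) d - inner ℝ (gradient f x) d
      - 2 * t * (L / 2 * ‖d‖ ^ 2)) t := by
    intro t
    have h1 := ((hasDerivAt_comp_add_smul hf x d t).sub
      ((hasDerivAt_id t).mul_const (inner ℝ (gradient f x) d))).sub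
      ((hasDerivAt_pow 2 t).mul_const (L / 2 * ‖d‖ ^ 2))
    simp only [one_mul, Nat.cast_ofNat, Nat.add_one_sub_one, pow_one] at h1
    exact h1
  have hanti : AntitoneOn g (Set.Icc 0 1) := by
    refine antitoneOn_of_deriv_nonpos (convex_Icc 0 1)
      (fun t _ => (hg t).continuousAt.continuousWithinAt)
      (fun t _ => (hg t).differentiableAt.differentiableWithinAt) fun t ht => ?_
    rw [interior_Icc] at ht
    rw [(hg t).deriv, ← inner_sub_left]
    have h1 := real_inner_le_norm (gradient f (x + t • d) - gradient f x) d
    have h2 : ‖gradient f (x + t • d) - gradient f x‖ ≤ L * (t * ‖d‖) := by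
      have := hL.norm_sub_le (x + t • d) x
      rwa [add_sub_cancel_left, norm_smul, Real.norm_of_nonneg ht.1.le] at this
    have h3 := mul_le_mul_of_nonneg_right h2 (norm_nonneg d)
    linarith
  have h := hanti (Set.left_mem_Icc.2 zero_le_one) (Set.right_mem_Icc.2 zero_le_one) zero_le_one
  have hxy : x + d = y := by rw [hd]; abel
  simp only [g, zero_smul, one_smul, add_zero, hxy, one_mul, zero_mul, one_pow, sub_zero,
    ne_eq, OfNat.ofNat_ne_zero, not_false_eq_true, zero_pow] at h
  linarith

/-- The three-point form of the Baillon–Haddad theorem. -/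
theorem neg_le_inner_gradient_sub {f : H → ℝ} (hc : ConvexOn ℝ Set.univ f)
    (hf : Differentiable ℝ f) {L : ℝ≥0} (hL : LipschitzWith L (gradient f)) (u v w : H) :
    -(L / 4 * ‖u - w‖ ^ 2) ≤ inner ℝ (gradient f w - gradient f v) (u - v) := by
  -- the test points `w + d` and `v - d` balance the two quadratic remainders
  set d : H := (1 / 2 : ℝ) • (u - w) with hd
  have h1 := add_inner_gradient_le hc hf v (w + d)
  have h2 := le_add_inner_gradient_add_sq hf hL w (w + d)
  have h3 := add_inner_gradient_le hc hf w (v - d)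
  have h4 := le_add_inner_gradient_add_sq hf hL v (v - d)
  have hn : ‖d‖ ^ 2 = ‖u - w‖ ^ 2 / 4 := by
    rw [hd, norm_smul, mul_pow]
    norm_num
    ring
  have hdu : u - v = (w - v) + (2 : ℝ) • d := by
    rw [hd, smul_smul]
    norm_num
  have e1 : w + d - v = (w - v) + d := by abel
  have e2 : v - d - w = -((w - v) + d) := by abel
  have e3 : v - d - v = -d := by abel
  rw [e1] at h1
  rw [add_sub_cancel_left] at h2
  rw [e2] at h3
  rw [e3, norm_neg] at h4
  rw [hdu, inner_sub_left]
  simp only [inner_add_right, inner_neg_right, inner_smul_right] at *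
  rw [hn] at h2 h4
  linarith

/-- Fermat's rule for the sum of a convex and a differentiable function. -/
theorem neg_gradient_mem_subdiff {f : H → EReal} (hf : IsProperConvexLsc f) {h : H → ℝ}
    (hh : Differentiable ℝ h) {x : H} (hx : f x ≠ ⊤)
    (hmin : ∀ z, f x + (h x : EReal) ≤ f z + (h z : EReal)) :
    -gradient h x ∈ subdiff f x := by
  intro z
  by_cases hz : f z = ⊤
  · simp [hz]
  obtain ⟨a, ha⟩ : ∃ a : ℝ, f x = a := ⟨_, (EReal.coe_toReal hx (hf.ne_bot x)).symm⟩
  obtain ⟨b, hb⟩ : ∃ b : ℝ, f z = b := ⟨_, (EReal.coe_toReal hz (hf.ne_bot z)).symm⟩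
  rw [ha, hb]
  norm_cast
  -- minimality on the segment from `x` to `z`, divided by the step length
  have key : ∀ t : ℝ, 0 < t → t < 1 → a - b ≤ slope (fun s : ℝ => h (x + s • (z - x))) 0 t := by
    intro t ht ht1
    have h1 := hf.convex x z (1 - t) t (by linarith) ht (by ring)
    have h2 := hmin ((1 - t) • x + t • z)
    have e : (1 - t) • x + t • z = x + t • (z - x) := by
      rw [sub_smul, smul_sub, one_smul]; abel
    rw [ha, hb] at h1
    have h3 := h2.trans (add_le_add_left h1 _)
    rw [ha, e] at h3
    norm_cast at h3
    rw [slope_def_field, le_div_iff₀ (by linarith)]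
    simp only [zero_smul, add_zero]
    nlinarith
  have hslope := (hasDerivAt_iff_tendsto_slope.1
    (hasDerivAt_comp_add_smul hh x (z - x) 0)).mono_left
    (nhdsWithin_mono _ fun t (ht : t ∈ Set.Ioi (0 : ℝ)) => ne_of_gt ht)
  have := ge_of_tendsto hslope (b := a - b) (by
    filter_upwards [Ioo_mem_nhdsGT (zero_lt_one' ℝ)] with t ht using key t ht.1 ht.2)
  simp only [zero_smul, add_zero] at this
  rw [inner_neg_left]
  linarith

end Smooth

/-! ### Inertial Fejér sequences -/

section Inertial

/-- A nonnegative sequence whose increments contract up to summable errors converges, and the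
decrease terms `r` are summable. The positive parts of the increments are summable, and subtracting
their partial sums leaves a nonincreasing sequence. -/
theorem exists_tendsto_and_summable_of_inertial {φ r δ a : ℕ → ℝ} {A : ℝ} (hA : A < 1)
    (ha : ∀ k, a k ∈ Set.Icc 0 A) (hφ : ∀ k, 0 ≤ φ k) (hr : ∀ k, 0 ≤ r k) (hδ : ∀ k, 0 ≤ δ k)
    (hδs : Summable δ)
    (h : ∀ k, φ (k + 2) - φ (k + 1) + r k ≤ a k * (φ (k + 1) - φ k) + δ k) :
    (∃ l, Tendsto φ atTop (𝓝 l)) ∧ Summable r := by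
  have hA0 : 0 ≤ A := (ha 0).1.trans (ha 0).2
  let t : ℕ → ℝ := fun k => max (φ (k + 1) - φ k) 0
  have ht0 : ∀ k, 0 ≤ t k := fun k => le_max_right _ _
  have hat : ∀ k, a k * (φ (k + 1) - φ k) ≤ A * t k := fun k =>
    (mul_le_mul_of_nonneg_left (le_max_left _ 0) (ha k).1).trans
      (mul_le_mul_of_nonneg_right (ha k).2 (ht0 k))
  have ht : ∀ k, t (k + 1) ≤ A * t k + δ k := fun k =>
    max_le (by linarith [h k, hr k, hat k])
      (add_nonneg (mul_nonneg hA0 (ht0 k)) (hδ k))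
  have hsum : ∀ n, ∑ k ∈ Finset.range n, δ k ≤ ∑' k, δ k := fun n =>
    hδs.sum_le_tsum _ fun k _ => hδ k
  have htsum : ∀ n, (1 - A) * ∑ k ∈ Finset.range n, t k + A * t n ≤
      A * t 0 + t 0 + ∑ k ∈ Finset.range n, δ k := by
    have key : ∀ n, (1 - A) * ∑ k ∈ Finset.range n, t k + t n ≤
        t 0 + ∑ k ∈ Finset.range n, δ k := by
      intro n
      induction n with
      | zero => simp
      | succ n ih =>
        rw [Finset.sum_range_succ, Finset.sum_range_succ]
        linarith [ht n]
    intro n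
    have h1 := mul_le_mul_of_nonneg_right hA.le (ht0 n)
    linarith [key n, mul_nonneg hA0 (ht0 0)]
  have hts : Summable t := by
    refine summable_of_sum_range_le (c := (A * t 0 + t 0 + ∑' k, δ k) / (1 - A)) ht0 fun n => ?_
    rw [le_div_iff₀ (by linarith)]
    linarith [htsum n, hsum n, mul_nonneg hA0 (ht0 n)]
  constructor
  · let ψ : ℕ → ℝ := fun n => φ n - ∑ k ∈ Finset.range n, t k
    have hψ : Antitone ψ := antitone_nat_of_succ_le fun n => by
      simp only [ψ, Finset.sum_range_succ]
      linarith [le_max_left (φ (n + 1) - φ n) 0]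
    have hb : BddBelow (Set.range ψ) := by
      refine ⟨-∑' k, t k, ?_⟩
      rintro _ ⟨n, rfl⟩
      have := hts.sum_le_tsum (Finset.range n) fun k _ => ht0 k
      simp only [ψ]
      linarith [hφ n]
    refine ⟨_, ((tendsto_atTop_ciInf hψ hb).add hts.hasSum.tendsto_sum_nat).congr fun n => ?_⟩
    simp [ψ]
  · refine summable_of_sum_range_le (c := φ 1 + A * ∑' k, t k + ∑' k, δ k) hr fun n => ?_
    have key : ∑ k ∈ Finset.range n, r k + φ (n + 1) ≤
        φ 1 + A * ∑ k ∈ Finset.range n, t k + ∑ k ∈ Finset.range n, δ k := by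
      induction n with
      | zero => simp
      | succ n ih =>
        simp only [Finset.sum_range_succ]
        linarith [h n, hat n]
    have := mul_le_mul_of_nonneg_left
      (hts.sum_le_tsum (Finset.range n) fun k _ => ht0 k) hA0
    linarith [hsum n, hφ (n + 1)]

variable {H : Type*} [NormedAddCommGroup H] [InnerProductSpace ℝ H]

/-- The extrapolated point `z (k + 1) + a k • (z (k + 1) - z k)`. -/
def inertialPoint (a : ℕ → ℝ) (z : ℕ → H) (k : ℕ) : H :=
  z (k + 1) + a k • (z (k + 1) - z k)

/-- Each term is obtained from the extrapolation of the two preceding ones by a step that does not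
increase the squared `M`-distance to `p`, up to the gain of its squared `R`-length. -/
def IsInertialFejer (M R : H →L[ℝ] H) (a : ℕ → ℝ) (z : ℕ → H) (p : H) : Prop :=
  ∀ k, inner ℝ (M (z (k + 2) - p)) (z (k + 2) - p)
      + inner ℝ (R (z (k + 2) - inertialPoint a z k)) (z (k + 2) - inertialPoint a z k)
    ≤ inner ℝ (M (inertialPoint a z k - p)) (inertialPoint a z k - p)

theorem tendsto_zero_of_inner_tendsto_zero {ι : Type*} {l : Filter ι} {M : H →L[ℝ] H} {c : ℝ}
    (hc : 0 < c) (hMc : ∀ u, c * ‖u‖ ^ 2 ≤ inner ℝ (M u) u) {d : ι → H}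
    (h : Tendsto (fun k => inner ℝ (M (d k)) (d k)) l (𝓝 0)) : Tendsto d l (𝓝 0) := by
  have h1 : Tendsto (fun k => ‖d k‖ ^ 2) l (𝓝 0) := by
    refine squeeze_zero (fun k => sq_nonneg _) (fun k => ?_) (by simpa using h.div_const c)
    rw [le_div_iff₀ hc, mul_comm]
    exact hMc _
  rw [tendsto_zero_iff_norm_tendsto_zero]
  simpa [Real.sqrt_sq] using h1.sqrt

theorem tendsto_sub_zero_of_lipschitz {ι E : Type*} [SeminormedAddCommGroup E] {l : Filter ι}
    {f : E → E} {L : ℝ≥0}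
    (hf : LipschitzWith L f) {u v : ι → E} (h : Tendsto (fun k => u k - v k) l (𝓝 0)) :
    Tendsto (fun k => f (u k) - f (v k)) l (𝓝 0) := by
  refine squeeze_zero_norm (fun k => hf.norm_sub_le (u k) (v k)) ?_
  simpa using h.norm.const_mul (L : ℝ)

/-- The square of an affine combination, in the quadratic form of a symmetric operator. -/
theorem inner_extrapolation_eq {M : H →L[ℝ] H}
    (hM : ∀ u v, inner ℝ (M u) v = inner ℝ (M v) u) (u v : H) (a : ℝ) :
    inner ℝ (M (u + a • (u - v))) (u + a • (u - v)) =
      (1 + a) * inner ℝ (M u) u - a * inner ℝ (M v) v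
        + a * (1 + a) * inner ℝ (M (u - v)) (u - v) := by
  simp only [map_add, map_sub, map_smul, inner_add_left, inner_add_right, inner_sub_left,
    inner_sub_right, inner_smul_left, inner_smul_right, RCLike.conj_to_real]
  rw [hM v u]
  ring

variable {M R : H →L[ℝ] H} {z : ℕ → H} {a : ℕ → ℝ} {A : ℝ} {p : H}

/-- Expansion of the Fejér inequality of one inertial step, with the extrapolated point
eliminated on the right. -/
theorem fejer_increment_le (hM : ∀ u v, inner ℝ (M u) v = inner ℝ (M v) u)
    (hfejer : IsInertialFejer M R a z p) (k : ℕ) :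
    inner ℝ (M (z (k + 2) - p)) (z (k + 2) - p) - inner ℝ (M (z (k + 1) - p)) (z (k + 1) - p)
        + inner ℝ (R (z (k + 2) - inertialPoint a z k)) (z (k + 2) - inertialPoint a z k)
      ≤ a k * (inner ℝ (M (z (k + 1) - p)) (z (k + 1) - p) - inner ℝ (M (z k - p)) (z k - p))
        + a k * (1 + a k) * inner ℝ (M (z (k + 1) - z k)) (z (k + 1) - z k) := by
  have h := hfejer k
  have e : inertialPoint a z k - p
      = (z (k + 1) - p) + a k • ((z (k + 1) - p) - (z k - p)) := by
    rw [inertialPoint, sub_sub_sub_cancel_right]; abel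
  rw [e, inner_extrapolation_eq hM, sub_sub_sub_cancel_right] at h
  linarith

/-- If the weighted squared steps are summable, an inertial Fejér sequence has convergent distances
to `p`, and its residuals are square summable. -/
theorem exists_tendsto_and_summable_of_fejer (hM : ∀ u v, inner ℝ (M u) v = inner ℝ (M v) u)
    (hM0 : ∀ u, 0 ≤ inner ℝ (M u) u) (hR0 : ∀ u, 0 ≤ inner ℝ (R u) u) (hA : A < 1)
    (ha : ∀ k, a k ∈ Set.Icc 0 A)
    (hfejer : IsInertialFejer M R a z p)
    (hs : Summable fun k => a k * inner ℝ (M (z (k + 1) - z k)) (z (k + 1) - z k)) :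
    (∃ l, Tendsto (fun k => inner ℝ (M (z k - p)) (z k - p)) atTop (𝓝 l)) ∧
      Summable fun k => inner ℝ (R (z (k + 2) - inertialPoint a z k))
        (z (k + 2) - inertialPoint a z k) := by
  have h0 : ∀ k, 0 ≤ a k * inner ℝ (M (z (k + 1) - z k)) (z (k + 1) - z k) :=
    fun k => mul_nonneg (ha k).1 (hM0 _)
  refine exists_tendsto_and_summable_of_inertial (a := a)
    (δ := fun k => 2 * (a k * inner ℝ (M (z (k + 1) - z k)) (z (k + 1) - z k))) hA ha
    (fun k => hM0 _) (fun k => hR0 _) (fun k => by linarith [h0 k]) (hs.mul_left 2) fun k => ?_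
  have h1 := fejer_increment_le hM hfejer k
  have h2 : 1 + a k ≤ 2 := by linarith [(ha k).2]
  have h3 := mul_le_mul_of_nonneg_right h2 (h0 k)
  linarith

/-- Square summability of the steps of an inertial Fejér sequence with nondecreasing inertia. The
energy `φ (k + 1) - a k * φ k + a k * ((1 + a k) * ‖z (k + 1) - z k‖²_M +
(1 - a k) * ‖z (k + 1) - z k‖²_R)`, with `φ k = ‖z k - p‖²_M`, decreases by at least
`ε * ‖z (k + 2) - z (k + 1)‖²_M`. -/
theorem summable_step_of_fejer (hM : ∀ u v, inner ℝ (M u) v = inner ℝ (M v) u)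
    (hR : ∀ u v, inner ℝ (R u) v = inner ℝ (R v) u)
    (hM0 : ∀ u, 0 ≤ inner ℝ (M u) u) (hR0 : ∀ u, 0 ≤ inner ℝ (R u) u) (hA : A < 1)
    (ha : ∀ k, a k ∈ Set.Icc 0 A)
    (hfejer : IsInertialFejer M R a z p)
    (hmono : Monotone a) {ε : ℝ} (hε : 0 < ε)
    (hcond : ∀ k u, (ε + a k + a k ^ 2) * inner ℝ (M u) u ≤ (1 - a k) ^ 2 * inner ℝ (R u) u) :
    Summable fun k => inner ℝ (M (z (k + 1) - z k)) (z (k + 1) - z k) := by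
  have hA0 : 0 ≤ A := (ha 0).1.trans (ha 0).2
  let φ : ℕ → ℝ := fun k => inner ℝ (M (z k - p)) (z k - p)
  let m : ℕ → ℝ := fun k => inner ℝ (M (z (k + 1) - z k)) (z (k + 1) - z k)
  let r : ℕ → ℝ := fun k => inner ℝ (R (z (k + 1) - z k)) (z (k + 1) - z k)
  let μ : ℕ → ℝ := fun k => φ (k + 1) - a k * φ k + a k * ((1 + a k) * m k + (1 - a k) * r k)
  have hφ : ∀ k, 0 ≤ φ k := fun k => hM0 _
  have hm : ∀ k, 0 ≤ m k := fun k => hM0 _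
  have hr : ∀ k, 0 ≤ r k := fun k => hR0 _
  have hdec : ∀ k, μ (k + 1) + ε * m (k + 1) ≤ μ k := by
    intro k
    have h1 : φ (k + 2) - φ (k + 1)
        + inner ℝ (R (z (k + 2) - inertialPoint a z k)) (z (k + 2) - inertialPoint a z k)
        ≤ a k * (φ (k + 1) - φ k) + a k * (1 + a k) * m k :=
      fejer_increment_le hM hfejer k
    -- the convexity bound `‖d' - a d‖² ≥ (1 - a) ‖d'‖² - a (1 - a) ‖d‖²`
    have h2 : (1 - a k) * r (k + 1) - a k * (1 - a k) * r k
        ≤ inner ℝ (R (z (k + 2) - inertialPoint a z k)) (z (k + 2) - inertialPoint a z k) := by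
      have e : z (k + 2) - inertialPoint a z k
          = (z (k + 2) - z (k + 1)) + (-a k) • (z (k + 1) - z k) := by
        rw [inertialPoint, neg_smul]; abel
      have h3 := mul_nonneg (ha k).1 (hR0 ((z (k + 2) - z (k + 1)) - (z (k + 1) - z k)))
      have e2 : r (k + 1) = inner ℝ (R (z (k + 2) - z (k + 1))) (z (k + 2) - z (k + 1)) := rfl
      rw [e, e2]
      simp only [r]
      generalize z (k + 2) - z (k + 1) = d' at *
      generalize z (k + 1) - z k = d at *
      simp only [map_add, map_sub, map_smul, inner_add_left, inner_add_right, inner_sub_left,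
        inner_sub_right, inner_smul_left, inner_smul_right, RCLike.conj_to_real] at h3 ⊢
      rw [hR d d'] at h3 ⊢
      linarith
    have h4 : (ε + a (k + 1) + a (k + 1) ^ 2) * m (k + 1)
        ≤ (1 - a (k + 1)) ^ 2 * r (k + 1) := hcond (k + 1) _
    have h5 : a k ≤ a (k + 1) := hmono (Nat.le_succ k)
    have h6 := mul_le_mul_of_nonneg_right h5 (hφ (k + 1))
    have h7 := mul_le_mul_of_nonneg_right h5 (hr (k + 1))
    simp only [μ]
    linarith
  have htel : ∀ n, μ n + ε * ∑ k ∈ Finset.range n, m (k + 1) ≤ μ 0 := by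
    intro n
    induction n with
    | zero => simp
    | succ n ih =>
      rw [Finset.sum_range_succ]
      linarith [hdec n]
  have hμ : ∀ n, φ (n + 1) - A * φ n ≤ μ n := by
    intro n
    have h1 := mul_le_mul_of_nonneg_right (ha n).2 (hφ n)
    have h2 : 0 ≤ a n * ((1 + a n) * m n + (1 - a n) * r n) :=
      mul_nonneg (ha n).1 (add_nonneg (mul_nonneg (by linarith [(ha n).1]) (hm n))
        (mul_nonneg (by linarith [(ha n).2]) (hr n)))
    simp only [μ]
    linarith
  have hsum0 : ∀ n, 0 ≤ ε * ∑ k ∈ Finset.range n, m (k + 1) := fun n =>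
    mul_nonneg hε.le (Finset.sum_nonneg fun k _ => hm _)
  -- the recursion `φ (n + 1) ≤ A * φ n + μ 0` keeps `φ` bounded
  obtain ⟨C, hC⟩ : ∃ C, ∀ n, φ n ≤ C := by
    refine ⟨max (φ 0) (|μ 0| / (1 - A)), fun n => ?_⟩
    set C := max (φ 0) (|μ 0| / (1 - A)) with hCdef
    have hC1 : |μ 0| ≤ C * (1 - A) := (div_le_iff₀ (by linarith)).1 (le_max_right _ _)
    induction n with
    | zero => exact le_max_left _ _
    | succ n ih =>
      have := mul_le_mul_of_nonneg_left ih hA0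
      linarith [hμ n, htel n, hsum0 n, le_abs_self (μ 0)]
  refine (summable_nat_add_iff 1).1
    (summable_of_sum_range_le (c := (μ 0 + A * C) / ε) (fun k => hm (k + 1)) fun n => ?_)
  rw [le_div_iff₀ hε]
  have := mul_le_mul_of_nonneg_left (hC n) hA0
  linarith [htel n, hμ n, hφ (n + 1)]

end Inertial

/-! ### Block operators -/

section Block

variable {X Y : Type*} [NormedAddCommGroup X] [InnerProductSpace ℝ X]
  [NormedAddCommGroup Y] [InnerProductSpace ℝ Y]

theorem WeaklyTendsto.fst {ι : Type*} {z : ι → WithLp 2 (X × Y)} {l : Filter ι}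
    {p : WithLp 2 (X × Y)} (h : WeaklyTendsto z l p) :
    WeaklyTendsto (fun k => (z k).fst) l p.fst := fun v => by
  simpa [WithLp.prod_inner_apply] using h (WithLp.toLp 2 (v, 0))

theorem WeaklyTendsto.snd {ι : Type*} {z : ι → WithLp 2 (X × Y)} {l : Filter ι}
    {p : WithLp 2 (X × Y)} (h : WeaklyTendsto z l p) :
    WeaklyTendsto (fun k => (z k).snd) l p.snd := fun v => by
  simpa [WithLp.prod_inner_apply] using h (WithLp.toLp 2 (0, v))

/-- Positive semidefiniteness of the block form `[p id, -s K*; -s K, q id]` when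
`s ^ 2 * ‖K‖ ^ 2 ≤ p * q`. -/
theorem two_mul_inner_le {p q s : ℝ} (hp : 0 ≤ p) (hq : 0 ≤ q) (hs : 0 ≤ s) {K : X →L[ℝ] Y}
    (h : s ^ 2 * ‖K‖ ^ 2 ≤ p * q) (x : X) (y : Y) :
    2 * (s * inner ℝ (K x) y) ≤ p * ‖x‖ ^ 2 + q * ‖y‖ ^ 2 := by
  have h1 : inner ℝ (K x) y ≤ ‖K‖ * ‖x‖ * ‖y‖ :=
    (real_inner_le_norm _ _).trans (mul_le_mul_of_nonneg_right (K.le_opNorm x) (norm_nonneg y))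
  have h2 : s * ‖K‖ ≤ √p * √q := by
    rw [← Real.sqrt_mul hp]
    exact Real.le_sqrt_of_sq_le (by rwa [mul_pow])
  have h3 := mul_le_mul_of_nonneg_left h1 hs
  have h4 := mul_le_mul_of_nonneg_right h2 (mul_nonneg (norm_nonneg x) (norm_nonneg y))
  have h5 := sq_nonneg (√p * ‖x‖ - √q * ‖y‖)
  have h6 : (√p * ‖x‖ - √q * ‖y‖) ^ 2
      = p * ‖x‖ ^ 2 + q * ‖y‖ ^ 2 - 2 * (√p * √q * (‖x‖ * ‖y‖)) := by
    rw [sub_sq, mul_pow, mul_pow, Real.sq_sqrt hp, Real.sq_sqrt hq]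
    ring
  linarith

variable [CompleteSpace X] [CompleteSpace Y]

/-- The block operator `[p id, -K*; -K, q id]` as a continuous linear map on `X × Y`. -/
noncomputable def blockOp (p q : ℝ) (K : X →L[ℝ] Y) :
    WithLp 2 (X × Y) →L[ℝ] WithLp 2 (X × Y) :=
  ((WithLp.prodContinuousLinearEquiv 2 ℝ X Y).symm : X × Y →L[ℝ] WithLp 2 (X × Y)) ∘L
    ((p • ContinuousLinearMap.fst ℝ X Y
        - ContinuousLinearMap.adjoint K ∘L ContinuousLinearMap.snd ℝ X Y).prod
      (q • ContinuousLinearMap.snd ℝ X Y - K ∘L ContinuousLinearMap.fst ℝ X Y)) ∘L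
    ((WithLp.prodContinuousLinearEquiv 2 ℝ X Y) : WithLp 2 (X × Y) →L[ℝ] X × Y)

theorem inner_blockOp (p q : ℝ) (K : X →L[ℝ] Y) (z w : WithLp 2 (X × Y)) :
    inner ℝ (blockOp p q K z) w = p * inner ℝ z.fst w.fst - inner ℝ z.snd (K w.fst)
      + (q * inner ℝ z.snd w.snd - inner ℝ (K z.fst) w.snd) := by
  simp [blockOp, WithLp.prod_inner_apply, inner_sub_left, inner_smul_left,
    ContinuousLinearMap.adjoint_inner_left]

theorem inner_blockOp_comm (p q : ℝ) (K : X →L[ℝ] Y) (z w : WithLp 2 (X × Y)) :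
    inner ℝ (blockOp p q K z) w = inner ℝ (blockOp p q K w) z := by
  rw [inner_blockOp, inner_blockOp, real_inner_comm w.fst z.fst, real_inner_comm w.snd z.snd,
    real_inner_comm (K z.fst) w.snd, real_inner_comm (K w.fst) z.snd]
  ring

theorem inner_blockOp_self (p q : ℝ) (K : X →L[ℝ] Y) (z : WithLp 2 (X × Y)) :
    inner ℝ (blockOp p q K z) z =
      p * ‖z.fst‖ ^ 2 - 2 * inner ℝ (K z.fst) z.snd + q * ‖z.snd‖ ^ 2 := by
  rw [inner_blockOp, real_inner_self_eq_norm_sq, real_inner_self_eq_norm_sq,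
    real_inner_comm (K z.fst) z.snd]
  ring

theorem metricNormSq_eq (τ σ : ℝ) (K : X →L[ℝ] Y) (z : WithLp 2 (X × Y)) :
    metricNormSq τ σ K z = inner ℝ (blockOp τ⁻¹ σ⁻¹ K z) z := by
  rw [metricNormSq]
  congr 1
  simp [metricOp, blockOp, neg_add_eq_sub]

/-- A block operator with positive diagonal and positive determinant is coercive. -/
theorem exists_le_inner_blockOp {p q : ℝ} (hp : 0 < p) (hq : 0 < q) {K : X →L[ℝ] Y}
    (h : ‖K‖ ^ 2 < p * q) :
    ∃ c > 0, ∀ z : WithLp 2 (X × Y), c * ‖z‖ ^ 2 ≤ inner ℝ (blockOp p q K z) z := by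
  -- lowering the diagonal by `c` lowers the determinant by at most `c * (p + q)`
  set c := (p * q - ‖K‖ ^ 2) / (p + q) with hcdef
  have hpq : 0 < p + q := add_pos hp hq
  have hc : 0 < c := div_pos (sub_pos.2 h) hpq
  have hcpq : c * (p + q) = p * q - ‖K‖ ^ 2 := div_mul_cancel₀ _ hpq.ne'
  have hK0 := sq_nonneg ‖K‖
  have hcp : c ≤ p := by
    rw [hcdef, div_le_iff₀ hpq]
    linarith [mul_pos hp hp]
  have hcq : c ≤ q := by
    rw [hcdef, div_le_iff₀ hpq]
    linarith [mul_pos hq hq]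
  refine ⟨c, hc, fun z => ?_⟩
  have h1 := two_mul_inner_le (s := 1) (K := K) (sub_nonneg.2 hcp) (sub_nonneg.2 hcq) zero_le_one
    (by linarith [mul_pos hc hc]) z.fst z.snd
  rw [inner_blockOp_self, WithLp.prod_norm_sq_eq_of_L2]
  linarith

end Block

/-! ### Subgradients and saddle points -/

section Subgradient

variable {H : Type*} [NormedAddCommGroup H] [InnerProductSpace ℝ H]

theorem inv_smul_sub_mem_of_mem_resolvent {t : ℝ} (ht : t ≠ 0) {T : H → Set H} {u v : H}
    (h : u ∈ resolvent t T v) : t⁻¹ • (v - u) ∈ T u := by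
  obtain ⟨p, hp, rfl⟩ := h
  rwa [add_sub_cancel_left, inv_smul_smul₀ ht]

theorem IsProperConvexLsc.ne_top_of_mem_subdiff {f : H → EReal} (hf : IsProperConvexLsc f)
    {x p : H} (hp : p ∈ subdiff f x) : f x ≠ ⊤ := by
  intro hx
  obtain ⟨z, hz⟩ := hf.exists_ne_top
  have := hp z
  rw [hx, EReal.top_add_coe, top_le_iff] at this
  exact hz this

theorem toReal_add_inner_le {f : H → EReal} (hf : IsProperConvexLsc f) {x p z : H}
    (hp : p ∈ subdiff f x) (hz : f z ≠ ⊤) :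
    (f x).toReal + inner ℝ p (z - x) ≤ (f z).toReal := by
  have := hp z
  rw [← EReal.coe_toReal (hf.ne_top_of_mem_subdiff hp) (hf.ne_bot x),
    ← EReal.coe_toReal hz (hf.ne_bot z)] at this
  exact_mod_cast this

theorem inner_sub_nonneg_of_mem_subdiff {f : H → EReal} (hf : IsProperConvexLsc f) {x y p q : H}
    (hp : p ∈ subdiff f x) (hq : q ∈ subdiff f y) : 0 ≤ inner ℝ (p - q) (x - y) := by
  have h1 := toReal_add_inner_le hf hp (hf.ne_top_of_mem_subdiff hq)
  have h2 := toReal_add_inner_le hf hq (hf.ne_top_of_mem_subdiff hp)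
  rw [← neg_sub x y, inner_neg_right] at h1
  rw [inner_sub_left]
  linarith

theorem tendsto_inner_zero {ι H : Type*} [NormedAddCommGroup H] [InnerProductSpace ℝ H]
    {l : Filter ι} {r u : ι → H} {C : ℝ} (hr : Tendsto r l (𝓝 0)) (v : H) (hu : ∀ k, ‖u k‖ ≤ C) :
    Tendsto (fun k => inner ℝ (r k) (v - u k)) l (𝓝 0) := by
  refine squeeze_zero_norm (a := fun k => ‖r k‖ * (‖v‖ + C)) (fun k => ?_)
    (by simpa using hr.norm.mul_const (‖v‖ + C))
  refine (norm_inner_le_norm _ _).trans (mul_le_mul_of_nonneg_left ?_ (norm_nonneg _))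
  linarith [norm_sub_le v (u k), hu k]

end Subgradient

section Saddle

variable {X Y : Type*} [NormedAddCommGroup X] [InnerProductSpace ℝ X]
  [NormedAddCommGroup Y] [InnerProductSpace ℝ Y]
  {G : X → EReal} {Fs : Y → EReal} {Q : X → ℝ} {Ps : Y → ℝ} {K : X →L[ℝ] Y}

theorem saddleFun_eq {x : X} {y : Y} {g f : ℝ} (hg : G x = g) (hf : Fs y = f) :
    saddleFun G Q K Fs Ps x y = ((g + (Q x + inner ℝ (K x) y - Ps y) - f : ℝ) : EReal) := by
  rw [saddleFun, hg, hf]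
  norm_cast

/-- The saddle point inequality, with the primal and the dual comparison combined into one. -/
theorem isSaddlePoint_of_le (hG : IsProperConvexLsc G) (hFs : IsProperConvexLsc Fs) {x : X} {y : Y}
    (h : ∀ x' y', G x' ≠ ⊤ → Fs y' ≠ ⊤ → G x + Fs y ≤ (((G x').toReal + (Fs y').toReal
      + (Q x' - Q x) + (Ps y' - Ps y) + inner ℝ (K x') y - inner ℝ (K x) y' : ℝ) : EReal)) :
    IsSaddlePoint G Q K Fs Ps x y := by
  obtain ⟨x₀, hx₀⟩ := hG.exists_ne_top
  obtain ⟨y₀, hy₀⟩ := hFs.exists_ne_top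
  have hsum : G x + Fs y ≠ ⊤ := ne_top_of_le_ne_top (EReal.coe_ne_top _) (h x₀ y₀ hx₀ hy₀)
  have hx : G x ≠ ⊤ := fun hx => hsum (by rw [hx, EReal.top_add_of_ne_bot (hFs.ne_bot y)])
  have hy : Fs y ≠ ⊤ := fun hy => hsum (by rw [hy, EReal.add_top_of_ne_bot (hG.ne_bot x)])
  have hg := (EReal.coe_toReal hx (hG.ne_bot x)).symm
  have hf := (EReal.coe_toReal hy (hFs.ne_bot y)).symm
  refine ⟨hx, hy, fun y' => ?_, fun x' => ?_⟩
  · by_cases hy' : Fs y' = ⊤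
    · simp [saddleFun, hy']
    have hf' := (EReal.coe_toReal hy' (hFs.ne_bot y')).symm
    have key := h x y' hx hy'
    rw [hg, hf, ← EReal.coe_add, EReal.coe_le_coe_iff] at key
    rw [saddleFun_eq hg hf, saddleFun_eq hg hf', EReal.coe_le_coe_iff]
    simp only [EReal.toReal_coe] at *
    linarith
  · by_cases hx' : G x' = ⊤
    · rw [show saddleFun G Q K Fs Ps x' y = ⊤ by
        rw [saddleFun, hx', hf, EReal.top_add_coe, EReal.top_sub_coe]]
      exact le_top
    have hg' := (EReal.coe_toReal hx' (hG.ne_bot x')).symm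
    have key := h x' y hx' hy
    rw [hg, hf, ← EReal.coe_add, EReal.coe_le_coe_iff] at key
    rw [saddleFun_eq hg hf, saddleFun_eq hg' hf, EReal.coe_le_coe_iff]
    simp only [EReal.toReal_coe] at *
    linarith

theorem gradient_add_inner {H : Type*} [NormedAddCommGroup H] [InnerProductSpace ℝ H]
    [CompleteSpace H] {f : H → ℝ} (hf : Differentiable ℝ f) (c x : H) :
    gradient (fun u => f u + inner ℝ c u) x = gradient f x + c := by
  refine HasGradientAt.gradient ?_
  rw [hasGradientAt_iff_hasFDerivAt, map_add]
  have h1 := (hf x).hasGradientAt.hasFDerivAt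
  have h2 := (InnerProductSpace.toDual ℝ H c).hasFDerivAt (x := x)
  simpa [InnerProductSpace.toDual_apply_apply] using! h1.add h2

variable [CompleteSpace Y]

theorem IsSaddlePoint.dual_mem_subdiff (hG : IsProperConvexLsc G) (hFs : IsProperConvexLsc Fs)
    (hP : Differentiable ℝ Ps) {x : X} {y : Y} (h : IsSaddlePoint G Q K Fs Ps x y) :
    -(gradient Ps y + -K x) ∈ subdiff Fs y := by
  rw [← gradient_add_inner hP]
  refine neg_gradient_mem_subdiff hFs
    (hP.add (InnerProductSpace.toDual ℝ Y (-K x)).differentiable)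
    h.dual_ne_top fun u => ?_
  by_cases hu : Fs u = ⊤
  · simp [hu]
  have hg := (EReal.coe_toReal h.primal_ne_top (hG.ne_bot x)).symm
  have hf := (EReal.coe_toReal h.dual_ne_top (hFs.ne_bot y)).symm
  have hf' := (EReal.coe_toReal hu (hFs.ne_bot u)).symm
  have key := h.max_right u
  rw [saddleFun_eq hg hf, saddleFun_eq hg hf', EReal.coe_le_coe_iff] at key
  rw [hf, hf']
  simp only [Pi.add_apply, InnerProductSpace.toDual_apply_apply]
  rw [inner_neg_left, inner_neg_left]
  norm_cast
  linarith

variable [CompleteSpace X]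

theorem IsSaddlePoint.primal_mem_subdiff (hG : IsProperConvexLsc G) (hFs : IsProperConvexLsc Fs)
    (hQ : Differentiable ℝ Q) {x : X} {y : Y} (h : IsSaddlePoint G Q K Fs Ps x y) :
    -(gradient Q x + ContinuousLinearMap.adjoint K y) ∈ subdiff G x := by
  rw [← gradient_add_inner hQ]
  refine neg_gradient_mem_subdiff hG
    (hQ.add (InnerProductSpace.toDual ℝ X (ContinuousLinearMap.adjoint K y)).differentiable)
    h.primal_ne_top fun u => ?_
  by_cases hu : G u = ⊤
  · simp [hu]
  have hg := (EReal.coe_toReal h.primal_ne_top (hG.ne_bot x)).symm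
  have hg' := (EReal.coe_toReal hu (hG.ne_bot u)).symm
  have hf := (EReal.coe_toReal h.dual_ne_top (hFs.ne_bot y)).symm
  have key := h.min_left u
  rw [saddleFun_eq hg hf, saddleFun_eq hg' hf, EReal.coe_le_coe_iff] at key
  rw [hg, hg']
  simp only [Pi.add_apply, InnerProductSpace.toDual_apply_apply]
  rw [ContinuousLinearMap.adjoint_inner_left, ContinuousLinearMap.adjoint_inner_left,
    real_inner_comm (K x), real_inner_comm (K u)]
  norm_cast
  linarith

/-- The optimality system is closed under weak convergence of the points together with strong
convergence to zero of the residuals: the coupling terms of the two subgradient inequalities cancel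
up to terms that are linear in the points. -/
theorem isSaddlePoint_of_weaklyTendsto (hG : IsProperConvexLsc G) (hFs : IsProperConvexLsc Fs)
    (hQc : ConvexOn ℝ Set.univ Q) (hQ : Differentiable ℝ Q)
    (hPc : ConvexOn ℝ Set.univ Ps) (hP : Differentiable ℝ Ps)
    {l : Filter ℕ} [l.NeBot] {x p : ℕ → X} {y q : ℕ → Y} {xs : X} {ys : Y} {C : ℝ}
    (hp : ∀ k, p k ∈ subdiff G (x k)) (hq : ∀ k, q k ∈ subdiff Fs (y k))
    (hxb : ∀ k, ‖x k‖ ≤ C) (hyb : ∀ k, ‖y k‖ ≤ C)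
    (hx : WeaklyTendsto x l xs) (hy : WeaklyTendsto y l ys)
    (hrp : Tendsto (fun k => p k + gradient Q (x k) + ContinuousLinearMap.adjoint K (y k)) l (𝓝 0))
    (hrq : Tendsto (fun k => q k + gradient Ps (y k) - K (x k)) l (𝓝 0)) :
    IsSaddlePoint G Q K Fs Ps xs ys := by
  refine isSaddlePoint_of_le hG hFs fun x' y' hx' hy' => ?_
  set e := fun k => p k + gradient Q (x k) + ContinuousLinearMap.adjoint K (y k) with he
  set e' := fun k => q k + gradient Ps (y k) - K (x k) with he'
  have hbound : ∀ k, (G (x k)).toReal + (Fs (y k)).toReal ≤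
      (G x').toReal + (Fs y').toReal + (Q x' - Q xs - inner ℝ (gradient Q xs) (x k - xs))
        + (Ps y' - Ps ys - inner ℝ (gradient Ps ys) (y k - ys))
        + inner ℝ (K x') (y k) - inner ℝ (ContinuousLinearMap.adjoint K y') (x k)
        - inner ℝ (e k) (x' - x k) - inner ℝ (e' k) (y' - y k) := by
    intro k
    have h1 := toReal_add_inner_le hG (hp k) hx'
    have h2 := toReal_add_inner_le hFs (hq k) hy'
    have h3 := add_inner_gradient_le hQc hQ xs (x k)
    have h4 := add_inner_gradient_le hQc hQ (x k) x'
    have h5 := add_inner_gradient_le hPc hP ys (y k)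
    have h6 := add_inner_gradient_le hPc hP (y k) y'
    simp only [he, he', inner_add_left, inner_sub_left (_ + _),
      ContinuousLinearMap.adjoint_inner_left, map_sub]
    rw [real_inner_comm (K (x k)) y']
    have h7 : inner ℝ (y k) (K x' - K (x k)) - inner ℝ (K (x k)) (y' - y k)
        = inner ℝ (K x') (y k) - inner ℝ (K (x k)) y' := by
      rw [inner_sub_right, inner_sub_right, real_inner_comm (K x'), real_inner_comm (K (x k))]
      ring
    linarith
  have hlim := (((((((hx (gradient Q xs)).sub_const (inner ℝ (gradient Q xs) xs)).const_sub
    (Q x' - Q xs)).const_add ((G x').toReal + (Fs y').toReal)).add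
    (((hy (gradient Ps ys)).sub_const (inner ℝ (gradient Ps ys) ys)).const_sub
    (Ps y' - Ps ys))).add (hy (K x'))).sub (hx (ContinuousLinearMap.adjoint K y'))).sub
    (tendsto_inner_zero hrp x' hxb) |>.sub (tendsto_inner_zero hrq y' hyb)
  simp only [sub_self, sub_zero, ← inner_sub_right] at hlim
  refine EReal.add_le_of_forall_lt fun a ha b hb => ?_
  induction a with
  | bot => simp
  | top => exact absurd ha (not_lt.2 le_top)
  | coe a =>
    induction b with
    | bot => simp
    | top => exact absurd hb (not_lt.2 le_top)
    | coe b =>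
      rw [← EReal.coe_add, EReal.coe_le_coe_iff]
      have hle := ge_of_tendsto (b := a + b) hlim (by
        filter_upwards [hG.eventually_lt hx ha, hFs.eventually_lt hy hb] with k hak hbk
        have h1 := hbound k
        have h2 := EReal.toReal_le_toReal hak.le (EReal.coe_ne_bot a)
          (hG.ne_top_of_mem_subdiff (hp k))
        have h3 := EReal.toReal_le_toReal hbk.le (EReal.coe_ne_bot b)
          (hFs.ne_top_of_mem_subdiff (hq k))
        rw [EReal.toReal_coe] at h2 h3
        linarith)
      rw [ContinuousLinearMap.adjoint_inner_left, real_inner_comm (K xs)] at hle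
      linarith

/-- One step of the method does not increase the squared `M`-distance to a saddle point. The
monotone coupling drops out, and the gradients cost a quarter of the form of
`L = diag (LQ, LP)` at `z - w`; doubling the inequality gives the gain of `M - L / 2`. -/
theorem fejer_step (hG : IsProperConvexLsc G) (hFs : IsProperConvexLsc Fs)
    (hQc : ConvexOn ℝ Set.univ Q) (hQ : Differentiable ℝ Q) {LQ LP : ℝ≥0}
    (hQl : LipschitzWith LQ (gradient Q)) (hPc : ConvexOn ℝ Set.univ Ps)
    (hP : Differentiable ℝ Ps) (hPl : LipschitzWith LP (gradient Ps)) {τ σ : ℝ}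
    {w z p : WithLp 2 (X × Y)} (hs : IsSaddlePoint G Q K Fs Ps p.fst p.snd)
    (hu : τ⁻¹ • (w.fst - z.fst) - gradient Q w.fst - ContinuousLinearMap.adjoint K w.snd
      ∈ subdiff G z.fst)
    (hv : σ⁻¹ • (w.snd - z.snd) - gradient Ps w.snd + K ((2 : ℝ) • z.fst - w.fst)
      ∈ subdiff Fs z.snd) :
    inner ℝ (blockOp τ⁻¹ σ⁻¹ K (z - p)) (z - p)
        + inner ℝ (blockOp (τ⁻¹ - LQ / 2) (σ⁻¹ - LP / 2) K (z - w)) (z - w)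
      ≤ inner ℝ (blockOp τ⁻¹ σ⁻¹ K (w - p)) (w - p) := by
  simp only [inner_blockOp_self, WithLp.sub_fst, WithLp.sub_snd]
  generalize w.fst = ξ at *
  generalize w.snd = ζ at *
  generalize z.fst = u at *
  generalize z.snd = v at *
  generalize p.fst = xs at *
  generalize p.snd = ys at *
  have h1 := inner_sub_nonneg_of_mem_subdiff hG hu (hs.primal_mem_subdiff hG hFs hQ)
  have h2 := inner_sub_nonneg_of_mem_subdiff hFs hv (hs.dual_mem_subdiff hG hFs hP)
  have h3 := neg_le_inner_gradient_sub hQc hQ hQl u xs ξ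
  have h4 := neg_le_inner_gradient_sub hPc hP hPl v ys ζ
  have e1 : τ⁻¹ • (ξ - u) - gradient Q ξ - ContinuousLinearMap.adjoint K ζ
      - -(gradient Q xs + ContinuousLinearMap.adjoint K ys)
      = τ⁻¹ • (ξ - u) - (gradient Q ξ - gradient Q xs)
        - ContinuousLinearMap.adjoint K ((ζ - v) + (v - ys)) := by
    rw [sub_add_sub_cancel, map_sub]; abel
  have e2 : σ⁻¹ • (ζ - v) - gradient Ps ζ + K ((2 : ℝ) • u - ξ) - -(gradient Ps ys + -K xs)
      = σ⁻¹ • (ζ - v) - (gradient Ps ζ - gradient Ps ys) + (K (u - xs) - K (ξ - u)) := by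
    simp only [map_sub, two_smul, map_add]; abel
  have e3 : ξ - xs = (ξ - u) + (u - xs) := by abel
  have e4 : ζ - ys = (ζ - v) + (v - ys) := by abel
  rw [e1] at h1
  rw [e2] at h2
  rw [norm_sub_rev] at h3 h4
  rw [← neg_sub ξ u, ← neg_sub ζ v, e3, e4]
  generalize ξ - u = d at *
  generalize ζ - v = d' at *
  generalize u - xs = b at *
  generalize v - ys = b' at *
  simp only [norm_add_sq_real, norm_neg, map_neg, map_add, inner_neg_neg, inner_add_left,
    inner_add_right, inner_sub_left (_ - _), inner_sub_left (_ • _), inner_sub_left (K _),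
    real_inner_smul_left, ContinuousLinearMap.adjoint_inner_left] at *
  rw [real_inner_comm (K b) d', real_inner_comm (K b) b'] at h1
  linarith

end Saddle

/-! ### The iterates in the product space -/

section Iterates

variable {X Y : Type*} [NormedAddCommGroup X] [InnerProductSpace ℝ X]
  [NormedAddCommGroup Y] [InnerProductSpace ℝ Y]

/-- The iterates as a sequence in `X × Y` indexed from `0`, so that the entry `k` is
`(x (k - 1), y (k - 1))`. -/
def pairSeq (xm : X) (ym : Y) (x : ℕ → X) (y : ℕ → Y) : ℕ → WithLp 2 (X × Y) :=
  prev (WithLp.toLp 2 (xm, ym)) fun k => WithLp.toLp 2 (x k, y k)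

variable {xm : X} {ym : Y} {x : ℕ → X} {y : ℕ → Y} {α : ℕ → ℝ}

theorem inertialPoint_pairSeq_fst (k : ℕ) :
    (inertialPoint α (pairSeq xm ym x y) k).fst = extrapolate α xm x k := by
  cases k <;> simp [inertialPoint, pairSeq, prev, extrapolate]

theorem inertialPoint_pairSeq_snd (k : ℕ) :
    (inertialPoint α (pairSeq xm ym x y) k).snd = extrapolate α ym y k := by
  cases k <;> simp [inertialPoint, pairSeq, prev, extrapolate]

variable [CompleteSpace X] [CompleteSpace Y] {G : X → EReal} {Fs : Y → EReal} {Q : X → ℝ}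
  {Ps : Y → ℝ} {K : X →L[ℝ] Y} {τ σ : ℝ}

theorem IsIterates.primal_mem_subdiff (h : IsIterates G Q K Fs Ps τ σ α xm ym x y) (hτ : τ ≠ 0)
    (k : ℕ) :
    τ⁻¹ • (extrapolate α xm x k - x (k + 1)) - gradient Q (extrapolate α xm x k)
      - ContinuousLinearMap.adjoint K (extrapolate α ym y k) ∈ subdiff G (x (k + 1)) := by
  convert inv_smul_sub_mem_of_mem_resolvent hτ (h.primal_step k) using 1
  rw [sub_right_comm (extrapolate α xm x k), smul_sub τ⁻¹ _ (τ • _), inv_smul_smul₀ hτ, sub_sub]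

theorem IsIterates.dual_mem_subdiff (h : IsIterates G Q K Fs Ps τ σ α xm ym x y) (hσ : σ ≠ 0)
    (k : ℕ) :
    σ⁻¹ • (extrapolate α ym y k - y (k + 1)) - gradient Ps (extrapolate α ym y k)
      + K ((2 : ℝ) • x (k + 1) - extrapolate α xm x k) ∈ subdiff Fs (y (k + 1)) := by
  convert inv_smul_sub_mem_of_mem_resolvent hσ (h.dual_step k) using 1
  rw [sub_right_comm (extrapolate α ym y k), smul_sub σ⁻¹ _ (σ • _), inv_smul_smul₀ hσ,
    sub_sub_eq_add_sub, sub_add_eq_add_sub]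

theorem IsIterates.isInertialFejer (h : IsIterates G Q K Fs Ps τ σ α xm ym x y)
    (hτ : τ ≠ 0) (hσ : σ ≠ 0) (hG : IsProperConvexLsc G) (hFs : IsProperConvexLsc Fs)
    (hQc : ConvexOn ℝ Set.univ Q) (hQ : Differentiable ℝ Q) {LQ LP : ℝ≥0}
    (hQl : LipschitzWith LQ (gradient Q)) (hPc : ConvexOn ℝ Set.univ Ps)
    (hP : Differentiable ℝ Ps) (hPl : LipschitzWith LP (gradient Ps))
    {p : WithLp 2 (X × Y)} (hs : IsSaddlePoint G Q K Fs Ps p.fst p.snd) :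
    IsInertialFejer (blockOp τ⁻¹ σ⁻¹ K) (blockOp (τ⁻¹ - LQ / 2) (σ⁻¹ - LP / 2) K) α
      (pairSeq xm ym x y) p := by
  intro k
  refine fejer_step hG hFs hQc hQ hQl hPc hP hPl hs ?_ ?_
  · rw [inertialPoint_pairSeq_fst, inertialPoint_pairSeq_snd]
    exact h.primal_mem_subdiff hτ k
  · rw [inertialPoint_pairSeq_fst, inertialPoint_pairSeq_snd]
    exact h.dual_mem_subdiff hσ k

/-- Weak cluster points of the iterates are saddle points once the residuals and the inertial
displacements vanish. -/
theorem IsIterates.isSaddlePoint_of_weaklyTendsto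
    (h : IsIterates G Q K Fs Ps τ σ α xm ym x y)
    (hτ : τ ≠ 0) (hσ : σ ≠ 0) (hG : IsProperConvexLsc G) (hFs : IsProperConvexLsc Fs)
    (hQc : ConvexOn ℝ Set.univ Q) (hQ : Differentiable ℝ Q) {LQ LP : ℝ≥0}
    (hQl : LipschitzWith LQ (gradient Q)) (hPc : ConvexOn ℝ Set.univ Ps)
    (hP : Differentiable ℝ Ps) (hPl : LipschitzWith LP (gradient Ps)) {C : ℝ}
    (hb : ∀ k, ‖pairSeq xm ym x y k‖ ≤ C)
    (hres : Tendsto (fun k => pairSeq xm ym x y (k + 2) - inertialPoint α (pairSeq xm ym x y) k)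
      atTop (𝓝 0))
    (hin : Tendsto (fun k => inertialPoint α (pairSeq xm ym x y) k - pairSeq xm ym x y (k + 1))
      atTop (𝓝 0))
    {l : Filter ℕ} [l.NeBot] (hl : l ≤ atTop) {p : WithLp 2 (X × Y)}
    (hp : WeaklyTendsto (fun k => pairSeq xm ym x y (k + 1)) l p) :
    IsSaddlePoint G Q K Fs Ps p.fst p.snd := by
  set z := pairSeq xm ym x y with hz
  -- the subgradients are taken at the next iterate, which has the same weak limit
  have hp' : WeaklyTendsto (fun k => z (k + 2)) l p := by
    intro v
    have h0 : Tendsto (fun k => z (k + 2) - z (k + 1)) l (𝓝 0) := by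
      simpa using (hres.add hin).mono_left hl
    have h1 := ((tendsto_const_nhds (x := v)).inner (𝕜 := ℝ) h0).add (hp v)
    rw [inner_zero_right, zero_add] at h1
    refine h1.congr fun k => ?_
    rw [← inner_add_right, sub_add_cancel]
  have hresX : Tendsto (fun k => extrapolate α xm x k - x (k + 1)) l (𝓝 0) := by
    have h1 := ((WithLp.fstL 2 ℝ X Y).continuous.tendsto 0).comp (hres.mono_left hl)
    have h2 := h1.neg
    simp only [map_zero, neg_zero] at h2
    refine h2.congr fun k => ?_
    rw [Function.comp_apply, map_sub, neg_sub]
    exact congrArg (· - _) (inertialPoint_pairSeq_fst k)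
  have hresY : Tendsto (fun k => extrapolate α ym y k - y (k + 1)) l (𝓝 0) := by
    have h1 := ((WithLp.sndL 2 ℝ X Y).continuous.tendsto 0).comp (hres.mono_left hl)
    have h2 := h1.neg
    simp only [map_zero, neg_zero] at h2
    refine h2.congr fun k => ?_
    rw [Function.comp_apply, map_sub, neg_sub]
    exact congrArg (· - _) (inertialPoint_pairSeq_snd k)
  have hgradX : Tendsto (fun k => gradient Q (extrapolate α xm x k) - gradient Q (x (k + 1))) l
      (𝓝 0) := tendsto_sub_zero_of_lipschitz hQl hresX
  have hgradY : Tendsto (fun k => gradient Ps (extrapolate α ym y k) - gradient Ps (y (k + 1))) l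
      (𝓝 0) := tendsto_sub_zero_of_lipschitz hPl hresY
  refine IPDFB.isSaddlePoint_of_weaklyTendsto hG hFs hQc hQ hPc hP (C := C) (l := l)
    (h.primal_mem_subdiff hτ) (h.dual_mem_subdiff hσ)
    (fun k => (WithLp.norm_fst_le _ (z (k + 2))).trans (hb _))
    (fun k => (WithLp.norm_snd_le _ (z (k + 2))).trans (hb _)) hp'.fst hp'.snd ?_ ?_
  · have h1 := ((hresX.const_smul τ⁻¹).sub hgradX).sub
      (((ContinuousLinearMap.adjoint K).continuous.tendsto 0).comp hresY)
    simp only [map_zero, smul_zero, sub_zero] at h1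
    refine h1.congr fun k => ?_
    simp only [Function.comp_apply, map_sub]
    abel
  · have h1 := ((hresY.const_smul σ⁻¹).sub hgradY).sub
      ((K.continuous.tendsto 0).comp hresX)
    simp only [map_zero, smul_zero, sub_zero] at h1
    refine h1.congr fun k => ?_
    simp only [Function.comp_apply, map_sub, two_smul, map_add]
    abel

end Iterates

end IPDFB
theorem theorem3 {X Y : Type*}
    [NormedAddCommGroup X] [InnerProductSpace ℝ X] [CompleteSpace X]
    [NormedAddCommGroup Y] [InnerProductSpace ℝ Y] [CompleteSpace Y]
    (G : X → EReal) (hG : IPDFB.IsProperConvexLsc G)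
    (Fs : Y → EReal) (hFs : IPDFB.IsProperConvexLsc Fs)
    (Q : X → ℝ) (LQ : ℝ≥0) (hQconv : ConvexOn ℝ Set.univ Q)
    (hQdiff : Differentiable ℝ Q) (hQlip : LipschitzWith LQ (gradient Q))
    (Ps : Y → ℝ) (LP : ℝ≥0) (hPconv : ConvexOn ℝ Set.univ Ps)
    (hPdiff : Differentiable ℝ Ps) (hPlip : LipschitzWith LP (gradient Ps))
    (K : X →L[ℝ] Y)
    (hsol : ∃ (x : X) (y : Y), IPDFB.IsSaddlePoint G Q K Fs Ps x y)
    -- `τ < 2 / LQ` and `σ < 2 / LP`, where `2 / 0` is read as `+∞`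
    (τ σ : ℝ) (hτ : 0 < τ) (hτQ : τ * LQ < 2) (hσ : 0 < σ) (hσP : σ * LP < 2)
    (hK : ‖K‖ ^ 2 < (1 / τ - LQ / 2) * (1 / σ - LP / 2))
    (α : ℕ → ℝ) (αmax : ℝ) (hαmax : αmax < 1) (hα : ∀ k, α k ∈ Set.Icc 0 αmax)
    (xm : X) (ym : Y) (x : ℕ → X) (y : ℕ → Y)
    (hiter : IPDFB.IsIterates G Q K Fs Ps τ σ α xm ym x y) :
    (Summable (fun k : ℕ => α (k + 1) * IPDFB.metricNormSq τ σ K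
        (WithLp.toLp 2 (x (k + 1), y (k + 1)) - WithLp.toLp 2 (x k, y k))) →
      ∃ (xs : X) (ys : Y), IPDFB.IsSaddlePoint G Q K Fs Ps xs ys ∧
        Tendsto (fun k => toWeakSpace ℝ (WithLp 2 (X × Y)) (WithLp.toLp 2 (x k, y k))) atTop
          (𝓝 (toWeakSpace ℝ (WithLp 2 (X × Y)) (WithLp.toLp 2 (xs, ys))))) ∧
    (Monotone α →
      (∃ ε > 0, ∀ k,
        (1 - α k) ^ 2 / 2 * LQ ≤ (1 - 3 * α k - ε) / τ ∧
        (1 - α k) ^ 2 / 2 * LP ≤ (1 - 3 * α k - ε) / σ ∧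
        (1 - 3 * α k - ε) ^ 2 * ‖K‖ ^ 2 ≤
          ((1 - 3 * α k - ε) / τ - (1 - α k) ^ 2 / 2 * LQ) *
            ((1 - 3 * α k - ε) / σ - (1 - α k) ^ 2 / 2 * LP)) →
      Summable (fun k : ℕ => α (k + 1) * IPDFB.metricNormSq τ σ K
        (WithLp.toLp 2 (x (k + 1), y (k + 1)) - WithLp.toLp 2 (x k, y k)))) := by
  have hτinv : τ⁻¹ = 1 / τ := (one_div τ).symm
  have hσinv : σ⁻¹ = 1 / σ := (one_div σ).symm
  have hp0 : 0 < τ⁻¹ - LQ / 2 := by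
    rw [hτinv, sub_pos, div_lt_div_iff₀ two_pos hτ]
    linarith
  have hq0 : 0 < σ⁻¹ - LP / 2 := by
    rw [hσinv, sub_pos, div_lt_div_iff₀ two_pos hσ]
    linarith
  rw [← hτinv, ← hσinv] at hK
  obtain ⟨c, hc, hRc⟩ := IPDFB.exists_le_inner_blockOp hp0 hq0 hK
  set M := IPDFB.blockOp τ⁻¹ σ⁻¹ K with hMdef
  set R := IPDFB.blockOp (τ⁻¹ - LQ / 2) (σ⁻¹ - LP / 2) K with hRdef
  have hMR : ∀ u, inner ℝ (R u) u
      = inner ℝ (M u) u - (LQ / 2 * ‖u.fst‖ ^ 2 + LP / 2 * ‖u.snd‖ ^ 2) := fun u => by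
    rw [hMdef, hRdef, IPDFB.inner_blockOp_self, IPDFB.inner_blockOp_self]
    ring
  have hMc : ∀ u, c * ‖u‖ ^ 2 ≤ inner ℝ (M u) u := fun u => by
    have h1 := hRc u
    have h2 : 0 ≤ (LQ : ℝ) / 2 * ‖u.fst‖ ^ 2 := by positivity
    have h3 : 0 ≤ (LP : ℝ) / 2 * ‖u.snd‖ ^ 2 := by positivity
    rw [hMR] at h1
    linarith
  have hM0 : ∀ u, 0 ≤ inner ℝ (M u) u := fun u => le_trans (by positivity) (hMc u)
  have hR0 : ∀ u, 0 ≤ inner ℝ (R u) u := fun u => le_trans (by positivity) (hRc u)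
  have hMs := IPDFB.inner_blockOp_comm τ⁻¹ σ⁻¹ K
  have hRs := IPDFB.inner_blockOp_comm (τ⁻¹ - LQ / 2) (σ⁻¹ - LP / 2) K
  set z := IPDFB.pairSeq xm ym x y with hz
  have hfejer : ∀ p : WithLp 2 (X × Y), IPDFB.IsSaddlePoint G Q K Fs Ps p.fst p.snd →
      IPDFB.IsInertialFejer M R α z p := fun p hp =>
    hiter.isInertialFejer hτ.ne' hσ.ne' hG hFs hQconv hQdiff hQlip hPconv hPdiff hPlip hp
  obtain ⟨xs₀, ys₀, hs₀⟩ := hsol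
  simp only [IPDFB.metricNormSq_eq]
  constructor
  · intro hsum
    -- the summability hypothesis omits the term of the step from `(xm, ym)` to `(x 0, y 0)`
    have hsum' : Summable fun k => α k * inner ℝ (M (z (k + 1) - z k)) (z (k + 1) - z k) :=
      (summable_nat_add_iff 1).1 hsum
    have hconv := fun p hp =>
      IPDFB.exists_tendsto_and_summable_of_fejer hMs hM0 hR0 hαmax hα (hfejer p hp) hsum'
    obtain ⟨⟨l₀, hl₀⟩, hres⟩ := hconv (WithLp.toLp 2 (xs₀, ys₀)) hs₀
    obtain ⟨C, hC⟩ := IPDFB.exists_norm_le_of_tendsto hc hMc hl₀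
    have hres0 := IPDFB.tendsto_zero_of_inner_tendsto_zero hc hRc hres.tendsto_atTop_zero
    have hin0 : Tendsto (fun k => IPDFB.inertialPoint α z k - z (k + 1)) atTop (𝓝 0) := by
      refine IPDFB.tendsto_zero_of_inner_tendsto_zero hc hMc
        (squeeze_zero (fun k => hM0 _) (fun k => ?_) hsum'.tendsto_atTop_zero)
      rw [IPDFB.inertialPoint, add_sub_cancel_left, map_smul, real_inner_smul_left,
        real_inner_smul_right]
      exact mul_le_mul_of_nonneg_left
        (mul_le_of_le_one_left (hM0 _) ((hα k).2.trans hαmax.le)) (hα k).1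
    obtain ⟨p, hp, hlim⟩ := IPDFB.exists_weaklyTendsto_of_opial (z := fun k => z (k + 1))
      (Z := {p | IPDFB.IsSaddlePoint G Q K Fs Ps p.fst p.snd}) hMs hc hMc
      ⟨WithLp.toLp 2 (xs₀, ys₀), hs₀⟩
      (fun p hp => by
        obtain ⟨l, hl⟩ := (hconv p hp).1
        exact ⟨l, hl.comp (tendsto_add_atTop_nat 1)⟩)
      (fun U hU p hp => hiter.isSaddlePoint_of_weaklyTendsto hτ.ne' hσ.ne' hG hFs hQconv hQdiff
        hQlip hPconv hPdiff hPlip hC hres0 hin0 hU hp)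
    exact ⟨p.fst, p.snd, hp, hlim.tendsto_toWeakSpace⟩
  · rintro hmono ⟨ε, hε, hcond⟩
    have hstep : Summable fun k => inner ℝ (M (z (k + 1) - z k)) (z (k + 1) - z k) := by
      refine IPDFB.summable_step_of_fejer hMs hRs hM0 hR0 hαmax hα
        (hfejer (WithLp.toLp 2 (xs₀, ys₀)) hs₀) hmono hε fun k u => ?_
      obtain ⟨h1, h2, h3⟩ := hcond k
      have hs : 0 ≤ 1 - 3 * α k - ε := by
        have h4 : 0 ≤ (1 - 3 * α k - ε) / τ := le_trans (by positivity) h1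
        simpa [hτ.ne'] using mul_nonneg h4 hτ.le
      have key := IPDFB.two_mul_inner_le (sub_nonneg.2 h1) (sub_nonneg.2 h2) hs h3 u.fst u.snd
      -- `(1 - a)² R - (ε + a + a²) M = (1 - 3 a - ε) M - (1 - a)² L / 2`
      rw [hMR, hMdef, IPDFB.inner_blockOp_self]
      rw [div_eq_mul_inv _ τ, div_eq_mul_inv _ σ] at key
      linarith
    refine ((summable_nat_add_iff 1).2 hstep).of_nonneg_of_le
      (fun k => mul_nonneg (hα _).1 (hM0 _)) fun k => ?_
    exact mul_le_of_le_one_left (hM0 _) ((hα _).2.trans hαmax.le)
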